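/- Consider the following dynamic matching market. Agents of type $H$ and $E$ arrive according to independent Poisson processes of rates $\lambda_H>0$ and $\lambda_E\ge 0$; initially the market holds only $d\ge 0$ altruistic agents, who own an item to give and want nothing ($d=0$: no chains). The compatibility graph has the agents as nodes and an edge $i\to j$ when the waiting agent $j$ finds the item of $i$ compatible. When an agent arrives, potential edges between her and the agents present are realized independently, an edge pointing to an agent of type $T$ having probability $p_T$. Exchanges take place along vertex-disjoint directed cycles of waiting agents and vertex-disjoint directed paths (chain-segments) that start at an altruistic or bridge agent. An agent stops waiting when she receives an item; the last agent of a chain-segment becomes a bridge agent, and a bridge or altruistic agent who gives her item disappears. An *anonymous Markovian* policy $\mathcal P$ chooses at each arrival epoch, possibly at random, a feasible set of disjoint exchanges as a function of the current compatibility graph only (newcomer included), and it commutes with every type-preserving renaming of the agents. It is *stable* if the resulting continuous-time Markov chain of compatibility graphs up to isomorphism has a stationary distribution to which it converges in law from the initial market. Let $w_T^{\mathcal P}\in[0,\infty]$ be the expected time that an agent of type $T$ arriving in steady state waits until she receives an item, with $w_T^{\mathcal P}:=0$ if $\lambda_T=0$. **Proposition.** Let $d\in\mathbb N$, $p_E\in[0,1]$,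 $\lambda_H>0$, $\lambda_E\ge0$, and let $\bar p=1$ if $d=0$, while $\bar p<1$ is arbitrary if $d\ge1$. There is a constant $c>0$, depending only on $d,p_E,\lambda_H,\lambda_E,\bar p$, such that for every $p_H\in(0,\bar p]$ and every stable anonymous Markovian policy $\mathcal P$, $$w_H^{\mathcal P}+w_E^{\mathcal P}\ \ge\ \frac{c}{p_H}.$$ -/

import Mathlib

open MeasureTheory ProbabilityTheory Filter Topology
open scoped ENNReal NNReal unitInterval

namespace DynamicMatching

/-- The two types of agents: hard-to-match and easy-to-match. -/
inductive AgentType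
  | H
  | E
  deriving DecidableEq

/-- Primitives of the market: Poisson arrival rates and compatibility probabilities. -/
structure Params where
  lamH : ℝ≥0
  lamE : ℝ≥0
  pH : I
  pE : I

/-- Arrival rate of agents of type `T`. -/
def Params.rate (θ : Params) : AgentType → ℝ≥0
  | .H => θ.lamH
  | .E => θ.lamE

/-- Total arrival rate. -/
def Params.totalRate (θ : Params) : ℝ≥0 := θ.lamH + θ.lamE

/-- A compatibility graph whose agents carry names in `ℕ`.  The nodes are the waiting agents of
type `H`, the waiting agents of type `E`, and the altruistic/bridge agents, who own an item to give
and do not wait for one.  An edge `(i, j)` says that `j` waits and finds the item of `i`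
compatible. -/
@[ext]
structure Market where
  hard : Finset ℕ
  easy : Finset ℕ
  bridges : Finset ℕ
  edges : Finset (ℕ × ℕ)
  disjoint_hard_easy : Disjoint hard easy
  disjoint_hard_bridges : Disjoint hard bridges
  disjoint_easy_bridges : Disjoint easy bridges
  source_mem : ∀ e ∈ edges, e.1 ∈ (hard ∪ easy) ∪ bridges
  target_mem : ∀ e ∈ edges, e.2 ∈ hard ∪ easy
  loopless : ∀ e ∈ edges, e.1 ≠ e.2

namespace Market

/-- The agents who are waiting for an item. -/
def waiting (m : Market) : Finset ℕ := m.hard ∪ m.easy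

/-- All nodes of the compatibility graph. -/
def nodes (m : Market) : Finset ℕ := m.waiting ∪ m.bridges

/-- The market at time zero: `d` altruistic agents and nobody waiting. -/
def initial (d : ℕ) : Market where
  hard := ∅
  easy := ∅
  bridges := Finset.range d
  edges := ∅
  disjoint_hard_easy := by simp
  disjoint_hard_bridges := by simp
  disjoint_easy_bridges := by simp
  source_mem := by simp
  target_mem := by simp
  loopless := by simp

/-- Renaming the agents. -/
def relabel (g : Equiv.Perm ℕ) (m : Market) : Market where
  hard := m.hard.map g.toEmbedding
  easy := m.easy.map g.toEmbedding
  bridges := m.bridges.map g.toEmbedding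
  edges := m.edges.map (g.prodCongr g).toEmbedding
  disjoint_hard_easy := (Finset.disjoint_map _).2 m.disjoint_hard_easy
  disjoint_hard_bridges := (Finset.disjoint_map _).2 m.disjoint_hard_bridges
  disjoint_easy_bridges := (Finset.disjoint_map _).2 m.disjoint_easy_bridges
  source_mem := by
    intro e he
    obtain ⟨f, hf, rfl⟩ := Finset.mem_map.1 he
    have h := m.source_mem f hf
    simpa using h
  target_mem := by
    intro e he
    obtain ⟨f, hf, rfl⟩ := Finset.mem_map.1 he
    have h := m.target_mem f hf
    simpa using h
  loopless := by
    intro e he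
    obtain ⟨f, hf, rfl⟩ := Finset.mem_map.1 he
    have h := m.loopless f hf
    simpa using h

/-- Two markets are isomorphic when they differ only in the names of the agents; types, the
bridge/waiting status and the compatibilities agree. -/
def isoSetoid : Setoid Market where
  r m m' := ∃ g : Equiv.Perm ℕ, m' = m.relabel g
  iseqv :=
    { refl := fun m => ⟨Equiv.refl ℕ, by ext <;> simp [relabel]⟩
      symm := by
        rintro m _ ⟨g, rfl⟩
        refine ⟨g.symm, ?_⟩
        ext <;> simp [relabel, Prod.map]
      trans := by
        rintro m _ _ ⟨g, rfl⟩ ⟨g', rfl⟩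
        refine ⟨g.trans g', ?_⟩
        ext <;> simp only [relabel, Finset.mem_map_equiv] <;> rfl }

/-- Compatibility graphs up to isomorphism. -/
def IsoClass : Type := Quotient isoSetoid

/-- The isomorphism class of a market. -/
def toClass (m : Market) : IsoClass := Quotient.mk isoSetoid m

/-- A name that is not in use; the next arriving agent receives it. -/
def fresh (m : Market) : ℕ := m.nodes.sup id + 1

/-- The fresh name is indeed unused. -/
theorem fresh_notMem (m : Market) : m.fresh ∉ m.nodes := fun h => by
  have : m.fresh ≤ m.nodes.sup id := Finset.le_sup (f := id) h
  unfold fresh at this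
  omega

/-- The ordered pairs on which an arriving agent gives rise to new potential edges: from every node
to the newcomer, and from the newcomer to every waiting agent. -/
def newPairs (m : Market) : Finset (ℕ × ℕ) :=
  (m.nodes ×ˢ {m.fresh}) ∪ ({m.fresh} ×ˢ m.waiting)

/-- The market after the arrival of an agent of type `T`, when `N` is the set of those new pairs
that turn out to be compatible. -/
def arrive (m : Market) (T : AgentType) (N : Finset (ℕ × ℕ)) : Market where
  hard := if T = .H then insert m.fresh m.hard else m.hard
  easy := if T = .E then insert m.fresh m.easy else m.easy
  bridges := m.bridges
  edges := m.edges ∪ (N ∩ m.newPairs)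
  disjoint_hard_easy := by
    have h := m.fresh_notMem
    have h' := m.disjoint_hard_easy
    simp only [nodes, waiting, Finset.mem_union, not_or] at h
    cases T <;> simp [h, h']
  disjoint_hard_bridges := by
    have h := m.fresh_notMem
    have h' := m.disjoint_hard_bridges
    simp only [nodes, waiting, Finset.mem_union, not_or] at h
    cases T <;> simp [h, h']
  disjoint_easy_bridges := by
    have h := m.fresh_notMem
    have h' := m.disjoint_easy_bridges
    simp only [nodes, waiting, Finset.mem_union, not_or] at h
    cases T <;> simp [h, h']
  source_mem := by
    intro e he
    obtain ⟨i, j⟩ := e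
    have h := m.source_mem (i, j)
    cases T <;> simp [newPairs, nodes, waiting] at he h ⊢ <;> grind
  target_mem := by
    intro e he
    obtain ⟨i, j⟩ := e
    have h := m.target_mem (i, j)
    cases T <;> simp [newPairs, nodes, waiting] at he h ⊢ <;> grind
  loopless := by
    intro e he heq
    have h := m.loopless e
    have h' := m.fresh_notMem
    simp only [newPairs, nodes, waiting, Finset.mem_union, Finset.mem_inter, Finset.mem_product,
      Finset.mem_singleton] at he h' ⊢
    rcases he with he | ⟨-, ⟨h1, h2⟩ | ⟨h1, h2⟩⟩
    · exact h he heq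
    · rw [heq, h2] at h1
      exact h' h1
    · rw [← heq, h1] at h2
      exact h' (Or.inl h2)

/-- A feasible set `M` of transactions; `(i, j) ∈ M` means that `j` receives the item of `i`.
Items move along edges of the compatibility graph only, every agent gives at most once and receives
at most once, and whoever gives is a bridge agent or receives an item as well.  Such an `M` is
exactly a disjoint union of directed cycles of waiting agents and of directed paths (chain-segments)
that start at a bridge or altruistic agent. -/
structure Feasible (m : Market) (M : Finset (ℕ × ℕ)) : Prop where
  subset_edges : M ⊆ m.edges
  gives_once : ∀ e ∈ M, ∀ f ∈ M, e.1 = f.1 → e = f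
  receives_once : ∀ e ∈ M, ∀ f ∈ M, e.2 = f.2 → e = f
  giver : ∀ e ∈ M, e.1 ∈ m.bridges ∨ ∃ f ∈ M, f.2 = e.1

/-- The market after the transactions `M`: whoever receives an item stops waiting and departs, the
last agent of a chain-segment stays on as a bridge agent, and a bridge agent who gives is removed. -/
def execute (m : Market) (M : Finset (ℕ × ℕ)) : Market where
  hard := m.hard \ M.image Prod.snd
  easy := m.easy \ M.image Prod.snd
  bridges := (m.bridges ∪ M.image Prod.snd) \ M.image Prod.fst
  edges := m.edges.filter fun e =>
    e.1 ∈ ((m.hard \ M.image Prod.snd) ∪ (m.easy \ M.image Prod.snd)) ∪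
        ((m.bridges ∪ M.image Prod.snd) \ M.image Prod.fst) ∧
      e.2 ∈ (m.hard \ M.image Prod.snd) ∪ (m.easy \ M.image Prod.snd)
  disjoint_hard_easy := m.disjoint_hard_easy.mono Finset.sdiff_subset Finset.sdiff_subset
  disjoint_hard_bridges := by
    have h := m.disjoint_hard_bridges
    rw [Finset.disjoint_left] at h ⊢
    intro a ha hb
    rw [Finset.mem_sdiff] at ha hb
    exact (Finset.mem_union.1 hb.1).elim (h ha.1) ha.2
  disjoint_easy_bridges := by
    have h := m.disjoint_easy_bridges
    rw [Finset.disjoint_left] at h ⊢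
    intro a ha hb
    rw [Finset.mem_sdiff] at ha hb
    exact (Finset.mem_union.1 hb.1).elim (h ha.1) ha.2
  source_mem := fun _ he => (Finset.mem_filter.1 he).2.1
  target_mem := fun _ he => (Finset.mem_filter.1 he).2.2
  loopless := fun e he => m.loopless e (Finset.mem_filter.1 he).1

end Market

/-- The law of the random subset of `S` that contains each `e ∈ S` independently with
probability `p e`. -/
noncomputable def randomSubset {α : Type*} [DecidableEq α] (S : Finset α) (p : α → I) :
    PMF (Finset α) :=
  PMF.ofFinset
    (fun A => if A ⊆ S then
      ENNReal.ofReal ((∏ e ∈ A, (p e : ℝ)) * ∏ e ∈ S \ A, (1 - (p e : ℝ))) else 0)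
    S.powerset
    (by
      have h0 : ∀ A ∈ S.powerset,
          0 ≤ (∏ e ∈ A, (p e : ℝ)) * ∏ e ∈ S \ A, (1 - (p e : ℝ)) := fun A _ =>
        mul_nonneg (Finset.prod_nonneg fun e _ => (p e).2.1)
          (Finset.prod_nonneg fun e _ => sub_nonneg.2 (p e).2.2)
      rw [Finset.sum_congr rfl (fun A hA => if_pos (Finset.mem_powerset.1 hA)),
        ← ENNReal.ofReal_sum_of_nonneg h0, ← Finset.prod_add]
      simp)
    (by
      intro A hA
      rw [if_neg (by simpa using hA)])

/-- The type of an arriving agent: by superposition of the two independent Poisson processes it is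
`H` with probability `lamH / (lamH + lamE)`, independently of everything else.  (If both rates
vanish, nobody ever arrives and this law is immaterial.) -/
noncomputable def arrivalType (θ : Params) : PMF AgentType :=
  (PMF.ofFintype (fun b : Bool =>
      cond b ((θ.lamH / θ.totalRate : ℝ≥0) : ℝ≥0∞) ((1 - θ.lamH / θ.totalRate : ℝ≥0) : ℝ≥0∞))
    (by
      have h : θ.lamH / θ.totalRate ≤ 1 := div_le_one_of_le₀ (by simp [Params.totalRate]) (by simp)
      rw [Fintype.sum_bool, cond_true, cond_false, ← ENNReal.coe_add, add_tsub_cancel_of_le h,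
        ENNReal.coe_one])).map
    fun b => cond b AgentType.H AgentType.E

/-- The random market right after an agent of type `T` has arrived and before any matching: each
new pair `(i, j)` becomes an edge independently, with probability `pH` or `pE` according to the type
of the receiver `j`. -/
noncomputable def arrivalLaw (θ : Params) (T : AgentType) (m : Market) : PMF Market :=
  (randomSubset m.newPairs
      (fun e => if e.2 ∈ (m.arrive T ∅).hard then θ.pH else θ.pE)).map
    (m.arrive T)

/-- An anonymous Markovian matching policy: at every arrival epoch it selects, possibly at random, a
feasible set of exchanges as a function of the current compatibility graph (newcomer included), and
it commutes with every renaming of the agents (which preserves types). -/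
structure Policy where
  choose : Market → PMF (Finset (ℕ × ℕ))
  feasible : ∀ m, ∀ M ∈ (choose m).support, m.Feasible M
  anonymous : ∀ (g : Equiv.Perm ℕ) (m : Market),
    choose (m.relabel g) = (choose m).map (Finset.map (g.prodCongr g).toEmbedding)

/-- One arrival of an agent of type `T`, followed by the exchanges that the policy selects. -/
noncomputable def stepOfType (θ : Params) (P : Policy) (T : AgentType) (m : Market) : PMF Market :=
  (arrivalLaw θ T m).bind fun m' => (P.choose m').map m'.execute

/-- The transition law of the market at an arrival epoch. -/
noncomputable def step (θ : Params) (P : Policy) (m : Market) : PMF Market :=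
  (arrivalType θ).bind fun T => stepOfType θ P T m

/-- The law of the market after `k` arrivals, from `m`. -/
noncomputable def stepN (θ : Params) (P : Policy) (m : Market) : ℕ → PMF Market
  | 0 => PMF.pure m
  | k + 1 => (stepN θ P m k).bind (step θ P)

/-- The probability that exactly `k` agents arrive during a time span of length `t`. -/
noncomputable def arrivalsProb (θ : Params) (t : ℝ≥0) (k : ℕ) : ℝ≥0∞ :=
  poissonMeasure (θ.totalRate * t) {k}

/-- Transition function of the continuous-time chain of compatibility graphs up to isomorphism: the
probability that at time `t` the market is in the class `c` if it is `m` at time `0`.  The market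
changes at the epochs of a Poisson process only, where it moves according to `step`. -/
noncomputable def transition (θ : Params) (P : Policy) (t : ℝ≥0) (m : Market)
    (c : Market.IsoClass) : ℝ≥0∞ :=
  ∑' k, arrivalsProb θ t k * (stepN θ P m k).map Market.toClass c

/-- `ρ` represents the steady state of the policy `P` in a market with `d` altruistic agents: its
law on isomorphism classes is stationary (the generator of the continuous-time chain is the total
arrival rate times `step` minus the identity), and the market that starts with the `d` altruistic
agents alone converges to it in law as time goes to infinity. -/
structure IsSteadyState (θ : Params) (d : ℕ) (P : Policy) (ρ : PMF Market) : Prop where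
  stationary : (ρ.bind (step θ P)).map Market.toClass = ρ.map Market.toClass
  ergodic : ∀ c : Market.IsoClass,
    Tendsto (fun t : ℝ≥0 => transition θ P t (Market.initial d) c) atTop
      (𝓝 (ρ.map Market.toClass c))

/-- The probability that the agent named `a` is waiting in the market `m` and is still there after
each of the next `k` arrivals. -/
noncomputable def stillWaiting (θ : Params) (P : Policy) (a : ℕ) : ℕ → Market → ℝ≥0∞
  | 0, m => if a ∈ m.waiting then 1 else 0
  | k + 1, m =>
      if a ∈ m.waiting then ∑' m', step θ P m m' * stillWaiting θ P a k m' else 0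

/-- The probability that an agent of type `T` who arrives when the market has law `ρ` is still
waiting after her own arrival epoch and the next `k` arrivals. -/
noncomputable def newcomerStillWaiting (θ : Params) (P : Policy) (ρ : PMF Market) (T : AgentType)
    (k : ℕ) : ℝ≥0∞ :=
  ∑' m, ρ m * ∑' m', stepOfType θ P T m m' * stillWaiting θ P m.fresh k m'

/-- The probability that the waiting time (departure time minus arrival time) of an agent of type
`T` who arrives when the market has law `ρ` exceeds `t`. -/
noncomputable def waitTail (θ : Params) (P : Policy) (ρ : PMF Market) (T : AgentType) (t : ℝ≥0) :
    ℝ≥0∞ :=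
  ∑' k, arrivalsProb θ t k * newcomerStillWaiting θ P ρ T k

/-- The expected waiting time of an agent of type `T` who arrives in steady state, as the integral
of the tail probabilities; it is `0` if there are no agents of type `T`.  It may be infinite. -/
noncomputable def waitingTime (θ : Params) (P : Policy) (ρ : PMF Market) (T : AgentType) : ℝ≥0∞ :=
  if θ.rate T = 0 then 0 else ∫⁻ t in Set.Ioi (0 : ℝ), waitTail θ P ρ T t.toNNReal

end DynamicMatching

namespace DynamicMatching

/-! Write `p` for `pH`, `l` for the total arrival rate and `S` for the sum of the two waiting times;
assume `S` is finite. If `S` is small, few agents are present, so a hard-to-match newcomer probably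
finds no compatible item; she must then wait for a later arrival to offer one, which takes about
`1/p` arrivals. So `S` cannot be small compared with `1/p`.

Counting the agents present calls for a Little-type inequality. Two obstacles arise: the expected
number of waiting agents might be infinite, and the steady state may contain agents who never leave.
Hence `expect_min_waitingSum_le` iterates stationarity on the truncation `min 1 (s * waitingSum r
m)`, and the bound is applied only to quantities `r` that die out along the life of an agent. By
`waitsForever_eq_zero_or_one`, each agent present leaves almost surely or stays almost surely;
`expect_min_leavers_le` bounds the leavers through the mean number of arrivals seen by a newcomer,
at most `l * S`.

Those who stay never receive an item, hence never give one, so edges out of them are harmless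
(`Blocked`). A hard newcomer is blocked with probability at least `(1-p)^d * (1 - p*n)`, with `n`
leavers and `d` bridge agents (their number is conserved), and each later arrival leaves her blocked
with probability at least `1-p`. Summing the geometric series gives `IsSteadyState.le_waitingTime`:
the waiting time of hard agents is at least `(1-p)^d * (1 - p*l*S) / (l*p)`. As `S` is at least that
time, solving for `S` gives the result. -/

/-! ### Expectations with respect to probability mass functions -/

/-- The expectation of a `ℝ≥0∞`-valued function with respect to a probability mass function. -/
noncomputable def expect {α : Type*} (μ : PMF α) (f : α → ℝ≥0∞) : ℝ≥0∞ := ∑' x, μ x * f x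

section Expect

variable {α β : Type*}

theorem expect_pure (a : α) (f : α → ℝ≥0∞) : expect (PMF.pure a) f = f a := by
  unfold expect
  rw [tsum_eq_single a (fun b hb => by simp [PMF.pure_apply_of_ne _ _ hb])]
  simp

theorem expect_bind (μ : PMF α) (κ : α → PMF β) (f : β → ℝ≥0∞) :
    expect (μ.bind κ) f = expect μ fun x => expect (κ x) f := by
  simp only [expect, PMF.bind_apply, ← ENNReal.tsum_mul_right, ← ENNReal.tsum_mul_left, mul_assoc]
  exact ENNReal.tsum_comm

theorem expect_map (μ : PMF α) (g : α → β) (f : β → ℝ≥0∞) :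
    expect (μ.map g) f = expect μ fun x => f (g x) := by
  rw [← PMF.bind_pure_comp, expect_bind]
  simp only [Function.comp_apply, expect_pure]

theorem expect_const (μ : PMF α) (c : ℝ≥0∞) : expect μ (fun _ => c) = c := by
  rw [expect, ENNReal.tsum_mul_right, PMF.tsum_coe, one_mul]

theorem expect_add (μ : PMF α) (f g : α → ℝ≥0∞) :
    expect μ (fun x => f x + g x) = expect μ f + expect μ g := by
  simp only [expect, mul_add, ENNReal.tsum_add]

theorem expect_mul_left (μ : PMF α) (c : ℝ≥0∞) (f : α → ℝ≥0∞) :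
    expect μ (fun x => c * f x) = c * expect μ f := by
  simp only [expect, ← ENNReal.tsum_mul_left]
  exact tsum_congr fun x => by ring

theorem expect_mono {μ : PMF α} {f g : α → ℝ≥0∞} (h : ∀ x ∈ μ.support, f x ≤ g x) :
    expect μ f ≤ expect μ g := by
  refine ENNReal.tsum_le_tsum fun x => ?_
  by_cases hx : x ∈ μ.support
  · exact mul_le_mul_right (h x hx) _
  · simp [(PMF.apply_eq_zero_iff μ x).2 hx]

theorem expect_congr {μ : PMF α} {f g : α → ℝ≥0∞} (h : ∀ x ∈ μ.support, f x = g x) :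
    expect μ f = expect μ g :=
  le_antisymm (expect_mono fun x hx => (h x hx).le) (expect_mono fun x hx => (h x hx).ge)

theorem expect_le_of_le {μ : PMF α} {f : α → ℝ≥0∞} {c : ℝ≥0∞} (h : ∀ x ∈ μ.support, f x ≤ c) :
    expect μ f ≤ c :=
  (expect_mono h).trans_eq (expect_const μ c)

theorem expect_finset_sum {ι : Type*} (μ : PMF α) (s : Finset ι) (f : ι → α → ℝ≥0∞) :
    expect μ (fun x => ∑ i ∈ s, f i x) = ∑ i ∈ s, expect μ (f i) := by
  simp only [expect, Finset.mul_sum]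
  exact Summable.tsum_finsetSum fun _ _ => ENNReal.summable

/-- The concave function `min 1` lies below its value at the mean. -/
theorem expect_min_one_le (μ : PMF α) (f : α → ℝ≥0∞) :
    expect μ (fun x => min 1 (f x)) ≤ min 1 (expect μ f) :=
  le_min (expect_le_of_le fun _ _ => min_le_left _ _) (expect_mono fun _ _ => min_le_right _ _)

theorem expect_eq_zero {μ : PMF α} {f : α → ℝ≥0∞} (h : expect μ f = 0) {x : α}
    (hx : x ∈ μ.support) : f x = 0 := by
  have := ENNReal.tsum_eq_zero.1 h x
  exact (mul_eq_zero.1 this).resolve_left ((PMF.mem_support_iff _ _).1 hx)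

theorem eq_one_of_expect_eq_one {μ : PMF α} {f : α → ℝ≥0∞} (hf : ∀ x, f x ≤ 1)
    (h : expect μ f = 1) {x : α} (hx : x ∈ μ.support) : f x = 1 := by
  have hadd : expect μ f + expect μ (fun x => 1 - f x) = 1 := by
    rw [← expect_add]
    simp only [add_tsub_cancel_of_le (hf _), expect_const]
  rw [h] at hadd
  have h0 : expect μ (fun x => 1 - f x) = 0 :=
    (ENNReal.add_right_inj ENNReal.one_ne_top).1 (hadd.trans (add_zero 1).symm)
  exact le_antisymm (hf x) (tsub_eq_zero_iff_le.1 (expect_eq_zero h0 hx))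

/-- Dominated convergence for bounded functions. -/
theorem tendsto_expect (μ : PMF α) {F : ℕ → α → ℝ≥0∞} {f : α → ℝ≥0∞} (hF : ∀ n x, F n x ≤ 1)
    (h : ∀ x, Tendsto (fun n => F n x) atTop (𝓝 (f x))) :
    Tendsto (fun n => expect μ (F n)) atTop (𝓝 (expect μ f)) := by
  -- Sums become integrals against counting measure, with the summable function `μ` as the
  -- dominating function.
  let _ : MeasurableSpace α := ⊤
  simp only [expect, ← lintegral_count]
  refine tendsto_lintegral_of_dominated_convergence (fun x => μ x) (fun _ => measurable_from_top)
    (fun n => Eventually.of_forall fun x => ?_) ?_ (Eventually.of_forall fun x => ?_)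
  · exact (mul_le_mul_right (hF n x) _).trans_eq (mul_one _)
  · rw [lintegral_count, PMF.tsum_coe]
    exact ENNReal.one_ne_top
  · exact ENNReal.Tendsto.const_mul (h x) (Or.inr (μ.apply_ne_top x))

/-- A lower bound for an expectation from a lower bound on an event. -/
theorem mul_expect_indicator_le {μ : PMF α} {f : α → ℝ≥0∞} {c : ℝ≥0∞} (s : Set α)
    (h : ∀ x ∈ μ.support, x ∈ s → c ≤ f x) :
    c * expect μ (s.indicator 1) ≤ expect μ f := by
  rw [← expect_mul_left]
  refine expect_mono fun x hx => ?_
  by_cases hs : x ∈ s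
  · simpa [hs] using h x hx hs
  · simp [hs]

end Expect

/-! ### Random subsets -/

/-- The probability that a random subset avoids a given set of elements of equal probability. -/
theorem expect_randomSubset_disjoint {α : Type*} [DecidableEq α] (S B : Finset α) (p : α → I)
    (hB : B ⊆ S) (q : I) (hq : ∀ e ∈ B, p e = q) :
    expect (randomSubset S p) ({A | Disjoint A B}.indicator 1) =
      ENNReal.ofReal ((1 - (q : ℝ)) ^ B.card) := by
  classical
  have h0 : ∀ A : Finset α, 0 ≤ (∏ e ∈ A, (p e : ℝ)) * ∏ e ∈ S \ A, (1 - (p e : ℝ)) := fun A =>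
    mul_nonneg (Finset.prod_nonneg fun e _ => (p e).2.1)
      (Finset.prod_nonneg fun e _ => sub_nonneg.2 (p e).2.2)
  have hzero : ∀ A ∉ (S \ B).powerset,
      randomSubset S p A * ({A | Disjoint A B}.indicator 1) A = 0 := by
    intro A hA
    by_cases hAS : A ⊆ S
    · have : ¬ Disjoint A B := fun h => hA (Finset.mem_powerset.2 (Finset.subset_sdiff.2 ⟨hAS, h⟩))
      simp [this]
    · simp [randomSubset, hAS]
  rw [expect, tsum_eq_sum (fun A hA => hzero A hA)]
  have hterm : ∀ A ∈ (S \ B).powerset,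
      randomSubset S p A * ({A | Disjoint A B}.indicator 1) A =
        ENNReal.ofReal ((∏ e ∈ A, (p e : ℝ)) * ∏ e ∈ S \ A, (1 - (p e : ℝ))) := by
    intro A hA
    obtain ⟨hAS, hAB⟩ := Finset.subset_sdiff.1 (Finset.mem_powerset.1 hA)
    simp [randomSubset, hAS, hAB]
  rw [Finset.sum_congr rfl hterm, ← ENNReal.ofReal_sum_of_nonneg fun A _ => h0 A]
  congr 1
  -- For `A` disjoint from `B`, the factors of the elements of `B` split off; the rest is the weight
  -- of `A` as a random subset of `S \ B`, and these weights sum to one.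
  have hsplit : ∀ A ∈ (S \ B).powerset,
      (∏ e ∈ A, (p e : ℝ)) * ∏ e ∈ S \ A, (1 - (p e : ℝ)) =
        (1 - (q : ℝ)) ^ B.card *
          ((∏ e ∈ A, (p e : ℝ)) * ∏ e ∈ (S \ B) \ A, (1 - (p e : ℝ))) := by
    intro A hA
    obtain ⟨hAS, hAB⟩ := Finset.subset_sdiff.1 (Finset.mem_powerset.1 hA)
    have hS : S \ A = B ∪ (S \ B) \ A := by
      ext e
      have h1 : e ∈ B → e ∈ S := fun h => hB h
      have h2 : e ∈ A → e ∉ B := fun h => Finset.disjoint_left.1 hAB h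
      simp only [Finset.mem_sdiff, Finset.mem_union]
      tauto
    have hd : Disjoint B ((S \ B) \ A) :=
      Finset.disjoint_left.2 fun e he h => (Finset.mem_sdiff.1 (Finset.mem_sdiff.1 h).1).2 he
    have hc : ∏ e ∈ B, (1 - (p e : ℝ)) = (1 - (q : ℝ)) ^ B.card := by
      rw [Finset.prod_congr rfl fun e he => congrArg (fun x : I => 1 - (x : ℝ)) (hq e he),
        Finset.prod_const]
    rw [hS, Finset.prod_union hd, hc]
    ring
  rw [Finset.sum_congr rfl hsplit, ← Finset.mul_sum, ← Finset.prod_add]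
  simp

/-- Random subsets commute with injective renamings. -/
theorem randomSubset_map_embedding {α : Type*} [DecidableEq α] (S : Finset α) (p p' : α → I)
    (g : α ↪ α) (h : ∀ e ∈ S, p' (g e) = p e) :
    randomSubset (S.map g) p' = (randomSubset S p).map (Finset.map g) := by
  refine PMF.ext fun A => ?_
  rw [PMF.map_apply]
  by_cases hA : A ⊆ S.map g
  · obtain ⟨A, hAS, rfl⟩ := Finset.subset_map_iff.1 hA
    refine Eq.symm ((tsum_eq_single A fun B hB =>
      if_neg fun h => hB (Finset.map_injective g h).symm).trans ?_)
    have h1 : ∏ e ∈ A, (p' (g e) : ℝ) = ∏ e ∈ A, (p e : ℝ) :=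
      Finset.prod_congr rfl fun e he => by rw [h e (hAS he)]
    have h2 : ∏ e ∈ S \ A, (1 - (p' (g e) : ℝ)) = ∏ e ∈ S \ A, (1 - (p e : ℝ)) :=
      Finset.prod_congr rfl fun e he => by rw [h e (Finset.mem_sdiff.1 he).1]
    simp only [randomSubset, PMF.ofFinset_apply, if_true, hA, hAS, ← Finset.map_sdiff,
      Finset.prod_map, h1, h2]
  · rw [show randomSubset (S.map g) p' A = 0 by simp [randomSubset, hA]]
    symm
    refine ENNReal.tsum_eq_zero.2 fun B => ?_
    split_ifs with hB
    · subst hB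
      have : ¬ B ⊆ S := fun hBS => hA (Finset.map_subset_map.2 hBS)
      simp [randomSubset, this]
    · rfl

/-! ### Poisson arrivals -/

/-- The left side is the expected time during which the arrival count equals `k`, an exponential
holding time, whatever `k` is. The computation is a Gamma integral. -/
theorem lintegral_arrivalsProb (θ : Params) (hθ : 0 < θ.totalRate) (k : ℕ) :
    ∫⁻ t in Set.Ioi (0 : ℝ), arrivalsProb θ t.toNNReal k = (θ.totalRate : ℝ≥0∞)⁻¹ := by
  set l : ℝ := (θ.totalRate : ℝ) with hl
  have hl0 : 0 < l := hθ
  have hfac : (0 : ℝ) < (k.factorial : ℝ) := by positivity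
  have hval : ∫ t in Set.Ioi (0 : ℝ), t ^ ((k + 1 : ℝ) - 1) * Real.exp (-(l * t)) =
      (1 / l) ^ (k + 1 : ℝ) * Real.Gamma (k + 1) :=
    Real.integral_rpow_mul_exp_neg_mul_Ioi (by positivity) hl0
  rw [Real.Gamma_nat_eq_factorial] at hval
  have hint : Integrable (fun t : ℝ => t ^ ((k + 1 : ℝ) - 1) * Real.exp (-(l * t)))
      (volume.restrict (Set.Ioi 0)) := by
    -- The Bochner integral of a non-integrable function is zero by convention, so a nonzero value
    -- proves integrability.
    refine Integrable.of_integral_ne_zero ?_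
    rw [hval]
    positivity
  have heq : ∀ t ∈ Set.Ioi (0 : ℝ), arrivalsProb θ t.toNNReal k =
      ENNReal.ofReal (l ^ k / k.factorial * (t ^ ((k + 1 : ℝ) - 1) * Real.exp (-(l * t)))) := by
    intro t ht
    rw [arrivalsProb, poissonMeasure_singleton]
    congr 1
    rw [NNReal.coe_mul, Real.coe_toNNReal t (le_of_lt ht), ← hl, add_sub_cancel_right,
      Real.rpow_natCast, mul_pow]
    ring
  rw [setLIntegral_congr_fun measurableSet_Ioi heq, ← ofReal_integral_eq_lintegral_ofReal
    (hint.const_mul _), integral_const_mul, hval]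
  · have : l ^ k / k.factorial * ((1 / l) ^ (k + 1 : ℝ) * k.factorial) = l⁻¹ := by
      rw [show ((k : ℝ) + 1) = ((k + 1 : ℕ) : ℝ) by push_cast; ring, Real.rpow_natCast]
      rw [one_div, inv_pow, pow_succ]
      field_simp
    rw [this, ENNReal.ofReal_inv_of_pos hl0, hl, ENNReal.ofReal_coe_nnreal]
  · refine (ae_restrict_iff' measurableSet_Ioi).2 (Eventually.of_forall fun t ht => ?_)
    have : (0 : ℝ) < t := ht
    positivity

theorem measurable_arrivalsProb (θ : Params) (k : ℕ) :
    Measurable fun t : ℝ => arrivalsProb θ t.toNNReal k := by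
  simp only [arrivalsProb, poissonMeasure_singleton]
  fun_prop

/-- The expected waiting time is the expected number of arrivals during which a newcomer waits,
divided by the total arrival rate. -/
theorem waitingTime_eq (θ : Params) (P : Policy) (ρ : PMF Market) (T : AgentType)
    (hT : θ.rate T ≠ 0) :
    waitingTime θ P ρ T =
      (θ.totalRate : ℝ≥0∞)⁻¹ * ∑' k, newcomerStillWaiting θ P ρ T k := by
  have hθ : 0 < θ.totalRate := by
    cases T
    · exact lt_of_lt_of_le (pos_iff_ne_zero.2 hT) (by simp [Params.rate, Params.totalRate])
    · exact lt_of_lt_of_le (pos_iff_ne_zero.2 hT) (by simp [Params.rate, Params.totalRate])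
  rw [waitingTime, if_neg hT]
  simp only [waitTail]
  rw [lintegral_tsum fun k => ((measurable_arrivalsProb θ k).mul_const _).aemeasurable,
    ← ENNReal.tsum_mul_left]
  refine tsum_congr fun k => ?_
  rw [lintegral_mul_const _ (measurable_arrivalsProb θ k), lintegral_arrivalsProb θ hθ]

/-! ### Equivariance of the transition law under renaming -/

namespace Market

theorem waiting_relabel (g : Equiv.Perm ℕ) (m : Market) :
    (m.relabel g).waiting = m.waiting.map g.toEmbedding := by
  simp only [waiting, relabel, Finset.map_union]

theorem nodes_relabel (g : Equiv.Perm ℕ) (m : Market) :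
    (m.relabel g).nodes = m.nodes.map g.toEmbedding := by
  rw [nodes, waiting_relabel, nodes, Finset.map_union]
  rfl

theorem waiting_subset_nodes (m : Market) : m.waiting ⊆ m.nodes := Finset.subset_union_left

theorem fresh_notMem_waiting (m : Market) : m.fresh ∉ m.waiting := fun h =>
  m.fresh_notMem (m.waiting_subset_nodes h)

/-- This leaves freedom to change a renaming outside the market. It is needed because `fresh` is
computed from the names themselves and does not commute with renamings. -/
theorem relabel_congr {g g' : Equiv.Perm ℕ} {m : Market} (h : ∀ a ∈ m.nodes, g a = g' a) :
    m.relabel g = m.relabel g' := by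
  have key : ∀ s ⊆ m.nodes, s.map g.toEmbedding = s.map g'.toEmbedding := fun s hs => by
    rw [Finset.map_eq_image, Finset.map_eq_image]
    exact Finset.image_congr fun a ha => h a (hs ha)
  have hH : m.hard ⊆ m.nodes := fun a ha => by simp [nodes, waiting, ha]
  have hE : m.easy ⊆ m.nodes := fun a ha => by simp [nodes, waiting, ha]
  have hB : m.bridges ⊆ m.nodes := fun a ha => by simp [nodes, ha]
  refine Market.ext (key _ hH) (key _ hE) (key _ hB) ?_
  simp only [relabel, Finset.map_eq_image]
  refine Finset.image_congr fun e he => ?_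
  have h1 : e.1 ∈ m.nodes := m.source_mem e he
  have h2 : e.2 ∈ m.nodes := m.waiting_subset_nodes (m.target_mem e he)
  exact Prod.ext (h _ h1) (h _ h2)

/-- A renaming can be altered outside the market so that it respects the name of the next
newcomer. -/
theorem exists_perm_fresh (g : Equiv.Perm ℕ) (m : Market) :
    ∃ g' : Equiv.Perm ℕ, (∀ a ∈ m.nodes, g a = g' a) ∧ g' m.fresh = (m.relabel g').fresh := by
  set f := (m.relabel g).fresh with hf
  -- Following `g` by the swap of `g m.fresh` and `f` changes no node: neither of these two names is
  -- the image of a node.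
  have hag : ∀ a ∈ m.nodes, g a = (g.trans (Equiv.swap (g m.fresh) f)) a := by
    intro a ha
    have h1 : g a ≠ g m.fresh := fun h => m.fresh_notMem (g.injective h ▸ ha)
    have h2 : g a ≠ f := fun h => (m.relabel g).fresh_notMem (by
      rw [← hf, ← h, nodes_relabel]
      exact Finset.mem_map_of_mem _ ha)
    rw [Equiv.trans_apply, Equiv.swap_apply_of_ne_of_ne h1 h2]
  refine ⟨g.trans (Equiv.swap (g m.fresh) f), hag, ?_⟩
  rw [← relabel_congr hag, Equiv.trans_apply, Equiv.swap_apply_left]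

theorem newPairs_relabel {g : Equiv.Perm ℕ} {m : Market} (hg : g m.fresh = (m.relabel g).fresh) :
    (m.relabel g).newPairs = m.newPairs.map (g.prodCongr g).toEmbedding := by
  have hs : ∀ x, x = (m.relabel g).fresh ↔ g.symm x = m.fresh := fun x => by
    rw [← hg, Equiv.symm_apply_eq]
  ext ⟨a, b⟩
  simp only [newPairs, waiting_relabel, nodes_relabel, Finset.mem_map_equiv, Finset.mem_union,
    Finset.mem_product, Finset.mem_singleton, hs]
  rfl

theorem arrive_relabel {g : Equiv.Perm ℕ} {m : Market} (hg : g m.fresh = (m.relabel g).fresh)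
    (T : AgentType) (N : Finset (ℕ × ℕ)) :
    (m.relabel g).arrive T (N.map (g.prodCongr g).toEmbedding) = (m.arrive T N).relabel g := by
  refine Market.ext ?_ ?_ rfl ?_
  · cases T
    · exact (congrArg (insert · _) hg.symm).trans (Finset.map_insert g.toEmbedding _ _).symm
    · rfl
  · cases T
    · rfl
    · exact (congrArg (insert · _) hg.symm).trans (Finset.map_insert g.toEmbedding _ _).symm
  · simp only [arrive, newPairs_relabel hg, ← Finset.map_inter]
    exact (Finset.map_union _ _).symm

theorem image_snd_map (g : Equiv.Perm ℕ) (M : Finset (ℕ × ℕ)) :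
    (M.map (g.prodCongr g).toEmbedding).image Prod.snd =
      (M.image Prod.snd).map g.toEmbedding := by
  simp only [Finset.map_eq_image, Finset.image_image]
  rfl

theorem image_fst_map (g : Equiv.Perm ℕ) (M : Finset (ℕ × ℕ)) :
    (M.map (g.prodCongr g).toEmbedding).image Prod.fst =
      (M.image Prod.fst).map g.toEmbedding := by
  simp only [Finset.map_eq_image, Finset.image_image]
  rfl

theorem execute_relabel (g : Equiv.Perm ℕ) (m : Market) (M : Finset (ℕ × ℕ)) :
    (m.relabel g).execute (M.map (g.prodCongr g).toEmbedding) = (m.execute M).relabel g := by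
  refine Market.ext ?_ ?_ ?_ ?_
  · simp only [execute, relabel, image_snd_map, Finset.map_sdiff]
  · simp only [execute, relabel, image_snd_map, Finset.map_sdiff]
  · simp only [execute, relabel, image_snd_map, image_fst_map, Finset.map_sdiff, Finset.map_union]
  · simp only [execute, relabel, image_snd_map, image_fst_map, ← Finset.map_sdiff,
      ← Finset.map_union]
    ext ⟨a, b⟩
    simp only [Finset.mem_filter, Finset.mem_map_equiv]
    rfl

end Market

variable (θ : Params) (P : Policy)

theorem arrivalLaw_relabel {g : Equiv.Perm ℕ} {m : Market}
    (hg : g m.fresh = (m.relabel g).fresh) (T : AgentType) :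
    arrivalLaw θ T (m.relabel g) = (arrivalLaw θ T m).map (Market.relabel g) := by
  have hp : ∀ e ∈ m.newPairs,
      (if ((g.prodCongr g).toEmbedding e).2 ∈ ((m.relabel g).arrive T ∅).hard then θ.pH else θ.pE)
        = if e.2 ∈ (m.arrive T ∅).hard then θ.pH else θ.pE := by
    intro e _
    have h := Market.arrive_relabel hg T ∅
    rw [Finset.map_empty] at h
    have hmem : ((g.prodCongr g).toEmbedding e).2 ∈ ((m.arrive T ∅).relabel g).hard ↔
        e.2 ∈ (m.arrive T ∅).hard := by
      change g e.2 ∈ (m.arrive T ∅).hard.map g.toEmbedding ↔ _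
      rw [Finset.mem_map_equiv, Equiv.symm_apply_apply]
    rw [h]
    simp only [hmem]
  rw [arrivalLaw, Market.newPairs_relabel hg, randomSubset_map_embedding _ _ _ _ hp, arrivalLaw,
    PMF.map_comp, PMF.map_comp]
  congr 1
  funext N
  exact Market.arrive_relabel hg T N

theorem stepOfType_relabel {g : Equiv.Perm ℕ} {m : Market}
    (hg : g m.fresh = (m.relabel g).fresh) (T : AgentType) :
    stepOfType θ P T (m.relabel g) = (stepOfType θ P T m).map (Market.relabel g) := by
  rw [stepOfType, arrivalLaw_relabel θ hg, PMF.bind_map, stepOfType, PMF.map_bind]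
  congr 1
  funext m'
  rw [Function.comp_apply, P.anonymous, PMF.map_comp, PMF.map_comp]
  congr 1
  funext M
  exact Market.execute_relabel g m' M

theorem step_relabel {g : Equiv.Perm ℕ} {m : Market} (hg : g m.fresh = (m.relabel g).fresh) :
    step θ P (m.relabel g) = (step θ P m).map (Market.relabel g) := by
  simp only [step, PMF.map_bind, stepOfType_relabel θ P hg]

/-! ### One-step dynamics -/

theorem mem_support_stepOfType {T : AgentType} {m m' : Market}
    (h : m' ∈ (stepOfType θ P T m).support) :
    ∃ N M, (m.arrive T N).Feasible M ∧ M ∈ (P.choose (m.arrive T N)).support ∧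
      m' = (m.arrive T N).execute M := by
  rw [stepOfType, PMF.mem_support_bind_iff] at h
  obtain ⟨m₁, h₁, h⟩ := h
  rw [arrivalLaw, PMF.mem_support_map_iff] at h₁
  obtain ⟨N, -, rfl⟩ := h₁
  obtain ⟨M, hM, rfl⟩ := (PMF.mem_support_map_iff _ _ _).1 h
  exact ⟨N, M, P.feasible _ M hM, hM, rfl⟩

theorem mem_support_step {m m' : Market} (h : m' ∈ (step θ P m).support) :
    ∃ T ∈ (arrivalType θ).support, m' ∈ (stepOfType θ P T m).support := by
  rw [step, PMF.mem_support_bind_iff] at h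
  exact h

theorem support_stepOfType_subset {T : AgentType} (hT : T ∈ (arrivalType θ).support) (m : Market) :
    (stepOfType θ P T m).support ⊆ (step θ P m).support := fun m' h => by
  rw [step, PMF.mem_support_bind_iff]
  exact ⟨T, hT, h⟩

theorem Market.waiting_execute (m : Market) (M : Finset (ℕ × ℕ)) :
    (m.execute M).waiting = m.waiting \ M.image Prod.snd :=
  (Finset.union_sdiff_distrib _ _ _).symm

theorem Market.waiting_arrive (m : Market) (T : AgentType) (N : Finset (ℕ × ℕ)) :
    (m.arrive T N).waiting = insert m.fresh m.waiting := by
  cases T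
  · exact Finset.insert_union _ _ _
  · exact Finset.union_insert _ _ _

theorem waiting_subset_of_mem_support {m m' : Market} (h : m' ∈ (step θ P m).support) :
    m'.waiting ⊆ insert m.fresh m.waiting := by
  obtain ⟨T, -, h⟩ := mem_support_step θ P h
  obtain ⟨N, M, -, -, rfl⟩ := mem_support_stepOfType θ P h
  rw [Market.waiting_execute, Market.waiting_arrive]
  exact Finset.sdiff_subset

/-! ### The survival operator -/

/-- The expectation of `r` for the agent `a` after the next arrival, if she is waiting before it. -/
noncomputable def survive (r : Market → ℕ → ℝ≥0∞) (m : Market) (a : ℕ) : ℝ≥0∞ :=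
  if a ∈ m.waiting then expect (step θ P m) (fun m' => r m' a) else 0

/-- The indicator of the waiting agents. -/
def isWaiting (m : Market) (a : ℕ) : ℝ≥0∞ := if a ∈ m.waiting then 1 else 0

/-- The probability that `a` waits in `m` and never receives an item. -/
noncomputable def waitsForever (m : Market) (a : ℕ) : ℝ≥0∞ := ⨅ k, stillWaiting θ P a k m

/-- Functions of a market and an agent that do not depend on names. -/
def NameInvariant (r : Market → ℕ → ℝ≥0∞) : Prop :=
  ∀ (g : Equiv.Perm ℕ) (m : Market) (a : ℕ), r (m.relabel g) (g a) = r m a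

/-- Membership must be tested at every stage, not only at the end, because the name of a departed
agent can be given to a later newcomer. -/
theorem stillWaiting_eq_iterate (k : ℕ) (m : Market) (a : ℕ) :
    stillWaiting θ P a k m = (survive θ P)^[k] isWaiting m a := by
  induction k generalizing m with
  | zero => rfl
  | succ k ih =>
    rw [Function.iterate_succ_apply', survive, stillWaiting]
    simp only [ih]
    rfl

theorem survive_mono {r r' : Market → ℕ → ℝ≥0∞} (h : ∀ m a, r m a ≤ r' m a) (m : Market) (a : ℕ) :
    survive θ P r m a ≤ survive θ P r' m a := by
  unfold survive
  split_ifs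
  · exact expect_mono fun m' _ => h m' a
  · exact le_rfl

theorem iterate_survive_mono {r r' : Market → ℕ → ℝ≥0∞} (h : ∀ m a, r m a ≤ r' m a) (k : ℕ)
    (m : Market) (a : ℕ) : (survive θ P)^[k] r m a ≤ (survive θ P)^[k] r' m a := by
  induction k generalizing m a with
  | zero => exact h m a
  | succ k ih =>
    rw [Function.iterate_succ_apply', Function.iterate_succ_apply']
    exact survive_mono θ P ih m a

theorem iterate_survive_add (r r' : Market → ℕ → ℝ≥0∞) (k : ℕ) (m : Market) (a : ℕ) :
    (survive θ P)^[k] (fun m a => r m a + r' m a) m a =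
      (survive θ P)^[k] r m a + (survive θ P)^[k] r' m a := by
  induction k generalizing m a with
  | zero => rfl
  | succ k ih =>
    simp only [Function.iterate_succ_apply']
    unfold survive
    split_ifs
    · rw [← expect_add]
      exact expect_congr fun m' _ => ih m' a
    · simp

theorem isWaiting_le_one (m : Market) (a : ℕ) : isWaiting m a ≤ 1 := by
  unfold isWaiting; split_ifs <;> simp

theorem stillWaiting_le_isWaiting (k : ℕ) (m : Market) (a : ℕ) :
    stillWaiting θ P a k m ≤ isWaiting m a := by
  induction k generalizing m with
  | zero => rfl
  | succ k ih =>
    rw [stillWaiting, isWaiting]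
    split_ifs
    · exact expect_le_of_le fun m' _ => (ih m').trans (isWaiting_le_one m' a)
    · exact le_rfl

theorem stillWaiting_le_one (k : ℕ) (m : Market) (a : ℕ) : stillWaiting θ P a k m ≤ 1 :=
  (stillWaiting_le_isWaiting θ P k m a).trans (isWaiting_le_one m a)

theorem stillWaiting_antitone (m : Market) (a : ℕ) :
    Antitone fun k => stillWaiting θ P a k m := by
  refine antitone_nat_of_succ_le fun k => ?_
  rw [stillWaiting_eq_iterate, stillWaiting_eq_iterate, Function.iterate_succ_apply]
  refine iterate_survive_mono θ P (fun m a => ?_) k m a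
  exact stillWaiting_le_isWaiting θ P 1 m a

theorem tendsto_stillWaiting (m : Market) (a : ℕ) :
    Tendsto (fun k => stillWaiting θ P a k m) atTop (𝓝 (waitsForever θ P m a)) :=
  tendsto_atTop_iInf (stillWaiting_antitone θ P m a)

theorem waitsForever_le_stillWaiting (k : ℕ) (m : Market) (a : ℕ) :
    waitsForever θ P m a ≤ stillWaiting θ P a k m := iInf_le _ k

theorem waitsForever_le_one (m : Market) (a : ℕ) : waitsForever θ P m a ≤ 1 :=
  (waitsForever_le_stillWaiting θ P 0 m a).trans (stillWaiting_le_one θ P 0 m a)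

theorem waitsForever_of_notMem {m : Market} {a : ℕ} (h : a ∉ m.waiting) :
    waitsForever θ P m a = 0 := by
  refine le_antisymm ((waitsForever_le_stillWaiting θ P 0 m a).trans ?_) zero_le
  simp [stillWaiting, h]

theorem mem_waiting_of_waitsForever {m : Market} {a : ℕ} (h : waitsForever θ P m a ≠ 0) :
    a ∈ m.waiting := by
  by_contra h'
  exact h (waitsForever_of_notMem θ P h')

/-- Both sides are limits of the same sequence `stillWaiting`, once shifted by one step; dominated
convergence passes the limit through the transition law. -/
theorem survive_waitsForever : survive θ P (waitsForever θ P) = waitsForever θ P := by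
  funext m a
  by_cases h : a ∈ m.waiting
  · have h1 := (tendsto_stillWaiting θ P m a).comp (tendsto_add_atTop_nat 1)
    have h2 := tendsto_expect (step θ P m) (F := fun k m' => stillWaiting θ P a k m')
      (fun k m' => stillWaiting_le_one θ P k m' a) (fun m' => tendsto_stillWaiting θ P m' a)
    rw [survive, if_pos h]
    refine tendsto_nhds_unique h2 (h1.congr fun k => ?_)
    simp only [Function.comp_apply, stillWaiting, if_pos h]
    rfl
  · rw [survive, if_neg h, waitsForever_of_notMem θ P h]

theorem iterate_survive_waitsForever (k : ℕ) :
    (survive θ P)^[k] (waitsForever θ P) = waitsForever θ P :=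
  Function.iterate_fixed (survive_waitsForever θ P) k

/-- Agents who wait forever with probability one are still there after the next arrival. -/
theorem waitsForever_eq_one_of_mem_support {m m' : Market} {a : ℕ} (h : waitsForever θ P m a = 1)
    (hm' : m' ∈ (step θ P m).support) : waitsForever θ P m' a = 1 := by
  have hw : a ∈ m.waiting := mem_waiting_of_waitsForever θ P (h ▸ one_ne_zero)
  refine eq_one_of_expect_eq_one (f := fun m' => waitsForever θ P m' a)
    (fun m' => waitsForever_le_one θ P m' a) ?_ hm'
  rw [← h, ← survive_waitsForever, survive, if_pos hw, survive_waitsForever]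

/-- A quantity bounded by the probability of leaving eventually dies out. -/
theorem tendsto_iterate_survive {r : Market → ℕ → ℝ≥0∞}
    (hr : ∀ m a, r m a + waitsForever θ P m a ≤ isWaiting m a) (m : Market) (a : ℕ) :
    Tendsto (fun k => (survive θ P)^[k] r m a) atTop (𝓝 0) := by
  -- `survive` is additive and monotone and fixes `waitsForever`, so iterating `hr` leaves exactly
  -- this gap.
  have hle : ∀ k, (survive θ P)^[k] r m a ≤ stillWaiting θ P a k m - waitsForever θ P m a := by
    intro k
    refine ENNReal.le_sub_of_add_le_right
      (ne_top_of_le_ne_top ENNReal.one_ne_top (waitsForever_le_one θ P m a)) ?_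
    have h := iterate_survive_mono θ P hr k m a
    rw [iterate_survive_add, iterate_survive_waitsForever, ← stillWaiting_eq_iterate] at h
    exact h
  have hlim : Tendsto (fun k => stillWaiting θ P a k m - waitsForever θ P m a) atTop
      (𝓝 (waitsForever θ P m a - waitsForever θ P m a)) :=
    ENNReal.Tendsto.sub (tendsto_stillWaiting θ P m a) tendsto_const_nhds
      (Or.inl (ne_top_of_le_ne_top ENNReal.one_ne_top (waitsForever_le_one θ P m a)))
  rw [tsub_self] at hlim
  exact tendsto_of_tendsto_of_tendsto_of_le_of_le tendsto_const_nhds hlim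
    (fun _ => zero_le) hle

/-! ### Invariance under renaming -/

theorem nameInvariant_isWaiting : NameInvariant isWaiting := fun g m a => by
  simp only [isWaiting, Market.waiting_relabel, Finset.mem_map_equiv, Equiv.symm_apply_apply]

-- The renaming is first corrected off the nodes so that it respects the next fresh name; then the
-- transition law commutes with it.
variable {θ P} in
theorem NameInvariant.survive {r : Market → ℕ → ℝ≥0∞} (hr : NameInvariant r) :
    NameInvariant (survive θ P r) := fun g m a => by
  obtain ⟨g', hag, hg'⟩ := Market.exists_perm_fresh g m
  have hw : g a ∈ (m.relabel g).waiting ↔ a ∈ m.waiting := by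
    rw [Market.waiting_relabel, Finset.mem_map_equiv, Equiv.symm_apply_apply]
  unfold DynamicMatching.survive
  simp only [hw]
  split_ifs with ha
  · rw [Market.relabel_congr hag, step_relabel θ P hg', expect_map,
      hag a (m.waiting_subset_nodes ha)]
    simp only [hr g' _ a]
  · rfl

variable {θ P} in
theorem NameInvariant.iterate_survive {r : Market → ℕ → ℝ≥0∞} (hr : NameInvariant r) (k : ℕ) :
    NameInvariant ((DynamicMatching.survive θ P)^[k] r) := by
  induction k with
  | zero => exact hr
  | succ k ih =>
    rw [Function.iterate_succ_apply']
    exact ih.survive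

theorem nameInvariant_waitsForever : NameInvariant (waitsForever θ P) := fun g m a => by
  refine iInf_congr fun k => ?_
  rw [stillWaiting_eq_iterate, stillWaiting_eq_iterate]
  exact nameInvariant_isWaiting.iterate_survive k g m a

/-! ### Balance of waiting agents and newcomers in the steady state -/

/-- The sum of `r` over the waiting agents. -/
noncomputable def waitingSum (r : Market → ℕ → ℝ≥0∞) (m : Market) : ℝ≥0∞ :=
  ∑ a ∈ m.waiting, r m a

theorem waitingSum_relabel {r : Market → ℕ → ℝ≥0∞} (hr : NameInvariant r) (g : Equiv.Perm ℕ)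
    (m : Market) : waitingSum r (m.relabel g) = waitingSum r m := by
  rw [waitingSum, Market.waiting_relabel, Finset.sum_map]
  exact Finset.sum_congr rfl fun a _ => hr g m a

/-- The expectation of `r` for an agent who arrives when the market has law `ρ`, right after her
own arrival epoch. -/
noncomputable def newcomerMean (ρ : PMF Market) (r : Market → ℕ → ℝ≥0∞) : ℝ≥0∞ :=
  expect ρ fun m => expect (step θ P m) fun m' => r m' m.fresh

theorem newcomerMean_mono (ρ : PMF Market) {r r' : Market → ℕ → ℝ≥0∞}
    (h : ∀ m a, r m a ≤ r' m a) : newcomerMean θ P ρ r ≤ newcomerMean θ P ρ r' :=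
  expect_mono fun _ _ => expect_mono fun _ _ => h _ _

theorem expect_step_waitingSum_le (r : Market → ℕ → ℝ≥0∞) (m : Market) :
    expect (step θ P m) (waitingSum r) ≤
      waitingSum (survive θ P r) m + expect (step θ P m) fun m' => r m' m.fresh := by
  calc expect (step θ P m) (waitingSum r)
      ≤ expect (step θ P m) (fun m' => (∑ a ∈ m.waiting, r m' a) + r m' m.fresh) := by
        refine expect_mono fun m' hm' => ?_
        rw [add_comm, ← Finset.sum_insert m.fresh_notMem_waiting]
        exact Finset.sum_le_sum_of_subset (waiting_subset_of_mem_support θ P hm')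
    _ = _ := by
        rw [expect_add, expect_finset_sum, waitingSum]
        congr 1
        exact Finset.sum_congr rfl fun a ha => (if_pos ha).symm

variable {θ P}

/-- Stationarity is only given on isomorphism classes, so `f` has to factor through them. -/
theorem expect_step_of_stationary {ρ : PMF Market}
    (hρ : (ρ.bind (step θ P)).map Market.toClass = ρ.map Market.toClass) {f : Market → ℝ≥0∞}
    (hf : ∀ g m, f (Market.relabel g m) = f m) :
    expect ρ f = expect ρ fun m => expect (step θ P m) f := by
  let F : Market.IsoClass → ℝ≥0∞ := Quotient.lift f (by
    rintro m _ ⟨g, rfl⟩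
    exact (hf g m).symm)
  have key : ∀ μ : PMF Market, expect μ f = expect (μ.map Market.toClass) F := fun μ => by
    rw [expect_map]
    rfl
  rw [← expect_bind, key, ← hρ, ← key]

/-- In the steady state, a quantity carried by the waiting agents is accounted for by what the
recent newcomers still carry and by what the agents initially present still carry. -/
theorem expect_min_waitingSum_le {ρ : PMF Market}
    (hρ : (ρ.bind (step θ P)).map Market.toClass = ρ.map Market.toClass)
    {r : Market → ℕ → ℝ≥0∞} (hr : NameInvariant r) (s : ℝ≥0∞) (k : ℕ) :
    expect ρ (fun m => min 1 (s * waitingSum r m)) ≤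
      expect ρ (fun m => min 1 (s * waitingSum ((survive θ P)^[k] r) m)) +
        s * ∑ j ∈ Finset.range k, newcomerMean θ P ρ ((survive θ P)^[j] r) := by
  induction k with
  | zero => simp
  | succ k ih =>
    refine ih.trans ?_
    rw [Finset.sum_range_succ, mul_add, add_comm (s * _), ← add_assoc]
    refine add_le_add ?_ le_rfl
    set r' := (survive θ P)^[k] r with hr'
    have hinv : NameInvariant r' := hr.iterate_survive k
    rw [Function.iterate_succ_apply', ← hr',
      expect_step_of_stationary hρ fun g m => by rw [waitingSum_relabel hinv],
      newcomerMean, ← expect_mul_left, ← expect_add]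
    refine expect_mono fun m _ => ?_
    -- Jensen for the concave `min 1`, then the one-step balance, and finally `min 1 (x + y) ≤ min 1
    -- x + y`, so that the newcomer term accumulates without truncation.
    calc _ ≤ min 1 (expect (step θ P m) fun m' => s * waitingSum r' m') := expect_min_one_le _ _
      _ ≤ min 1 (s * waitingSum (survive θ P r') m +
            s * expect (step θ P m) fun m' => r' m' m.fresh) := by
          rw [expect_mul_left, ← mul_add]
          exact min_le_min_left _ (mul_le_mul_right (expect_step_waitingSum_le θ P r' m) _)
      _ ≤ _ := by
          rcases le_total 1 (s * waitingSum (survive θ P r') m) with h | h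
          · rw [min_eq_left h]
            exact (min_le_left _ _).trans le_self_add
          · rw [min_eq_right h]
            exact min_le_right _ _

/-- In the steady state, a quantity that eventually dies out is accounted for by the newcomers. -/
theorem expect_min_waitingSum_le_tsum {ρ : PMF Market}
    (hρ : (ρ.bind (step θ P)).map Market.toClass = ρ.map Market.toClass)
    {r : Market → ℕ → ℝ≥0∞} (hinv : NameInvariant r)
    (hr : ∀ m a, r m a + waitsForever θ P m a ≤ isWaiting m a) {s : ℝ≥0∞} (hs : s ≠ ∞) :
    expect ρ (fun m => min 1 (s * waitingSum r m)) ≤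
      s * ∑' j, newcomerMean θ P ρ ((survive θ P)^[j] r) := by
  have hlim : Tendsto
      (fun k => expect ρ (fun m => min 1 (s * waitingSum ((survive θ P)^[k] r) m))) atTop
      (𝓝 (expect ρ fun _ => 0)) := by
    refine tendsto_expect ρ (fun _ _ => min_le_left _ _) fun m => ?_
    have h1 : Tendsto (fun k => waitingSum ((survive θ P)^[k] r) m) atTop (𝓝 0) := by
      have := tendsto_finsetSum m.waiting
        fun a _ => tendsto_iterate_survive θ P hr m a
      simpa [waitingSum] using this
    have h2 := ENNReal.Tendsto.const_mul h1 (Or.inr hs)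
    have h3 := (tendsto_const_nhds (x := (1 : ℝ≥0∞))).min h2
    simpa using h3
  rw [expect_const] at hlim
  have hlim' := hlim.add_const (s * ∑' j, newcomerMean θ P ρ ((survive θ P)^[j] r))
  rw [zero_add] at hlim'
  refine ge_of_tendsto' hlim' fun k => (expect_min_waitingSum_le hρ hinv s k).trans ?_
  exact add_le_add le_rfl (mul_le_mul_right (ENNReal.sum_le_tsum _) _)

/-- The expected number of agents who leave eventually, in terms of the newcomers. -/
theorem expect_min_leavers_le {ρ : PMF Market}
    (hρ : (ρ.bind (step θ P)).map Market.toClass = ρ.map Market.toClass) {s : ℝ≥0∞} (hs : s ≠ ∞) :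
    expect ρ (fun m => min 1 (s * waitingSum
        (fun m a => isWaiting m a - waitsForever θ P m a) m)) ≤
      s * ∑' j, newcomerMean θ P ρ (fun m a => stillWaiting θ P a j m) := by
  refine (expect_min_waitingSum_le_tsum (θ := θ) (P := P) hρ (fun g m a => ?_) (fun m a => ?_)
    hs).trans (mul_le_mul_right (ENNReal.tsum_le_tsum fun j => ?_) _)
  · rw [nameInvariant_isWaiting, nameInvariant_waitsForever]
  · rw [tsub_add_cancel_of_le]
    exact waitsForever_le_stillWaiting θ P 0 m a
  · refine newcomerMean_mono θ P ρ fun m a => ?_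
    rw [stillWaiting_eq_iterate]
    exact iterate_survive_mono θ P (fun m a => tsub_le_self) j m a

/-- In a steady state in which newcomers wait for an integrable time, each agent present either
leaves almost surely or waits forever almost surely. -/
theorem waitsForever_eq_zero_or_one {ρ : PMF Market}
    (hρ : (ρ.bind (step θ P)).map Market.toClass = ρ.map Market.toClass)
    (hfin : ∑' j, newcomerMean θ P ρ (fun m a => stillWaiting θ P a j m) ≠ ∞)
    {m : Market} (hm : m ∈ ρ.support) {a : ℕ} (ha : a ∈ m.waiting) :
    waitsForever θ P m a = 0 ∨ waitsForever θ P m a = 1 := by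
  -- The terms of a finite sum tend to zero and dominate the probability that a newcomer never
  -- leaves.
  have hzero : newcomerMean θ P ρ (waitsForever θ P) = 0 := by
    refine le_antisymm (ge_of_tendsto' (ENNReal.tendsto_atTop_zero_of_tsum_ne_top hfin) fun j => ?_)
      zero_le
    exact newcomerMean_mono θ P ρ fun m a => waitsForever_le_stillWaiting θ P j m a
  -- This product vanishes exactly in the two desired cases. It is at most the probability of
  -- leaving, so it dies out; it is at most `waitsForever`, so no newcomer ever carries any of it.
  -- The balance inequality then forces it to vanish.
  set r : Market → ℕ → ℝ≥0∞ := fun m a =>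
    waitsForever θ P m a * (isWaiting m a - waitsForever θ P m a) with hr
  have hle : ∀ m a, waitsForever θ P m a ≤ isWaiting m a := waitsForever_le_stillWaiting θ P 0
  have h0 : expect ρ (fun m => min 1 (1 * waitingSum r m)) = 0 := by
    refine le_antisymm ((expect_min_waitingSum_le_tsum (θ := θ) (P := P) hρ (fun g m a => ?_)
      (fun m a => ?_) ENNReal.one_ne_top).trans ?_) zero_le
    · simp only [hr]
      rw [nameInvariant_isWaiting, nameInvariant_waitsForever]
    · refine (add_le_add (mul_le_of_le_one_left zero_le (waitsForever_le_one θ P m a))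
        le_rfl).trans_eq (tsub_add_cancel_of_le (hle m a))
    · rw [one_mul, ENNReal.tsum_eq_zero.2 fun j => ?_]
      refine le_antisymm (le_of_le_of_eq (newcomerMean_mono θ P ρ fun m a => ?_) hzero) zero_le
      refine (iterate_survive_mono θ P (r' := waitsForever θ P) (fun m a => ?_) j m a).trans_eq
        (by rw [iterate_survive_waitsForever])
      exact mul_le_of_le_one_right zero_le (tsub_le_self.trans (isWaiting_le_one m a))
  have h1 := expect_eq_zero h0 hm
  rw [one_mul] at h1
  have h2 : waitingSum r m = 0 := by
    rcases min_choice 1 (waitingSum r m) with h | h <;> rw [h] at h1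
    · exact absurd h1 one_ne_zero
    · exact h1
  have h3 : r m a = 0 := (Finset.sum_eq_zero_iff.1 h2) a ha
  rcases mul_eq_zero.1 h3 with h | h
  · exact Or.inl h
  · rw [isWaiting, if_pos ha] at h
    exact Or.inr (le_antisymm (waitsForever_le_one θ P m a) (tsub_eq_zero_iff_le.1 h))

/-! ### The number of bridge agents is conserved -/

/-- Givers and receivers are equally many, receivers are not bridge agents beforehand, and every
giver lies among the old bridge agents and the receivers. -/
theorem Market.Feasible.card_bridges_execute {m : Market} {M : Finset (ℕ × ℕ)}
    (h : m.Feasible M) : (m.execute M).bridges.card = m.bridges.card := by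
  have hfst : (M.image Prod.fst).card = M.card :=
    Finset.card_image_of_injOn fun e he f hf => h.gives_once e he f hf
  have hsnd : (M.image Prod.snd).card = M.card :=
    Finset.card_image_of_injOn fun e he f hf => h.receives_once e he f hf
  have hsub : M.image Prod.fst ⊆ m.bridges ∪ M.image Prod.snd := by
    intro a ha
    obtain ⟨e, he, rfl⟩ := Finset.mem_image.1 ha
    rcases h.giver e he with hb | ⟨f, hf, hfe⟩
    · exact Finset.mem_union_left _ hb
    · exact Finset.mem_union_right _ (Finset.mem_image.2 ⟨f, hf, hfe⟩)
  have hdisj : Disjoint m.bridges (M.image Prod.snd) := by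
    refine Finset.disjoint_left.2 fun a ha hs => ?_
    obtain ⟨e, he, rfl⟩ := Finset.mem_image.1 hs
    rcases Finset.mem_union.1 (m.target_mem e (h.subset_edges he)) with h' | h'
    · exact Finset.disjoint_left.1 m.disjoint_hard_bridges h' ha
    · exact Finset.disjoint_left.1 m.disjoint_easy_bridges h' ha
  change ((m.bridges ∪ M.image Prod.snd) \ M.image Prod.fst).card = _
  rw [Finset.card_sdiff_of_subset hsub, Finset.card_union_of_disjoint hdisj, hfst, hsnd,
    Nat.add_sub_cancel]

theorem card_bridges_of_mem_support_step {m m' : Market} (h : m' ∈ (step θ P m).support) :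
    m'.bridges.card = m.bridges.card := by
  obtain ⟨T, -, h⟩ := mem_support_step θ P h
  obtain ⟨N, M, hM, -, rfl⟩ := mem_support_stepOfType θ P h
  exact hM.card_bridges_execute

theorem card_bridges_of_mem_support_stepN {m : Market} {k : ℕ} :
    ∀ {m' : Market}, m' ∈ (stepN θ P m k).support → m'.bridges.card = m.bridges.card := by
  induction k with
  | zero =>
    intro m' h
    rw [stepN, PMF.mem_support_pure_iff] at h
    rw [h]
  | succ k ih =>
    intro m' h
    rw [stepN, PMF.mem_support_bind_iff] at h
    obtain ⟨m₁, h₁, h⟩ := h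
    exact (card_bridges_of_mem_support_step h).trans (ih h₁)

/-- Convergence from the initial market makes every class charged by `ρ` reachable from it, and the
count is constant along the way. Stationarity alone would not determine it. -/
theorem IsSteadyState.card_bridges {d : ℕ} {ρ : PMF Market} (h : IsSteadyState θ d P ρ)
    {m : Market} (hm : m ∈ ρ.support) : m.bridges.card = d := by
  have hpos : ρ.map Market.toClass m.toClass ≠ 0 :=
    (PMF.mem_support_iff _ _).1 ((PMF.mem_support_map_iff _ _ _).2 ⟨m, hm, rfl⟩)
  obtain ⟨t, ht⟩ := ((h.ergodic m.toClass).eventually_ne hpos).exists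
  obtain ⟨k, hk⟩ := not_forall.1 (mt ENNReal.tsum_eq_zero.2 ht)
  obtain ⟨m', hm', heq⟩ := (PMF.mem_support_map_iff _ _ _).1
    ((PMF.mem_support_iff _ _).2 (mul_ne_zero_iff.1 hk).2)
  obtain ⟨g, rfl⟩ : ∃ g : Equiv.Perm ℕ, m = m'.relabel g := Quotient.exact heq
  rw [Market.relabel, Finset.card_map, card_bridges_of_mem_support_stepN hm']
  exact Finset.card_range d

/-! ### Waiting for the first usable edge -/

variable (θ P) in
/-- The hard-to-match agent `b` has no incoming edge that might ever be used: all her in-neighbours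
wait forever. -/
def Blocked (m : Market) (b : ℕ) : Prop :=
  b ∈ m.hard ∧ ∀ x, (x, b) ∈ m.edges → waitsForever θ P m x = 1

theorem Blocked.mem_waiting {m : Market} {b : ℕ} (h : Blocked θ P m b) : b ∈ m.waiting :=
  Finset.mem_union_left _ h.1

/-- The in-neighbours of `b` wait forever, so they are still waiting after the exchange: they were
not bridge agents and did not receive, hence could not have given to `b`. -/
theorem blocked_execute {m m₁ : Market} {b : ℕ} {M : Finset (ℕ × ℕ)} (hM : m₁.Feasible M)
    (hb : b ∈ m₁.hard) (hforever : ∀ x, (x, b) ∈ m₁.edges → waitsForever θ P m x = 1)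
    (hm' : m₁.execute M ∈ (step θ P m).support) : Blocked θ P (m₁.execute M) b := by
  have hu : ∀ x, (x, b) ∈ m₁.edges → waitsForever θ P (m₁.execute M) x = 1 := fun x hx =>
    waitsForever_eq_one_of_mem_support θ P (hforever x hx) hm'
  refine ⟨Finset.mem_sdiff.2 ⟨hb, fun hr => ?_⟩, fun x hx => hu x (Finset.mem_filter.1 hx).1⟩
  obtain ⟨⟨x, b'⟩, he, rfl⟩ := Finset.mem_image.1 hr
  have hx := mem_waiting_of_waitsForever θ P ((hu x (hM.subset_edges he)).trans_ne one_ne_zero)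
  rw [Market.waiting_execute, Finset.mem_sdiff] at hx
  rcases hM.giver _ he with h | ⟨f, hf, hfx⟩
  · rcases Finset.mem_union.1 hx.1 with h' | h'
    · exact Finset.disjoint_left.1 m₁.disjoint_hard_bridges h' h
    · exact Finset.disjoint_left.1 m₁.disjoint_easy_bridges h' h
  · exact hx.2 (Finset.mem_image.2 ⟨f, hf, hfx⟩)

/-- An agent remains blocked whenever a prescribed set of new pairs towards her fails to be
compatible. -/
theorem mul_le_expect_stepOfType {T : AgentType} (hT : T ∈ (arrivalType θ).support) {m : Market}
    {b : ℕ} (hb : b ∈ (m.arrive T ∅).hard) {B : Finset (ℕ × ℕ)} (hB : B ⊆ m.newPairs)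
    (hBb : ∀ e ∈ B, e.2 = b) (hold : ∀ x, (x, b) ∈ m.edges → waitsForever θ P m x = 1)
    (hnew : ∀ x, (x, b) ∈ m.newPairs → (x, b) ∉ B → waitsForever θ P m x = 1)
    {f : Market → ℝ≥0∞} {c : ℝ≥0∞} (hf : ∀ m', Blocked θ P m' b → c ≤ f m') :
    c * ENNReal.ofReal ((1 - (θ.pH : ℝ)) ^ B.card) ≤ expect (stepOfType θ P T m) f := by
  rw [stepOfType, expect_bind, arrivalLaw, expect_map,
    ← expect_randomSubset_disjoint m.newPairs B _ hB θ.pH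
      fun e he => if_pos (show e.2 ∈ (m.arrive T ∅).hard from (hBb e he).symm ▸ hb)]
  refine mul_expect_indicator_le _ fun N hN hNB => ?_
  rw [expect_map, ← expect_const (P.choose (m.arrive T N)) c]
  refine expect_mono fun M hM => hf _ (blocked_execute (m := m) (P.feasible _ M hM) hb ?_ ?_)
  · intro x hx
    rcases Finset.mem_union.1 hx with hx | hx
    · exact hold x hx
    · obtain ⟨hxN, hxm⟩ := Finset.mem_inter.1 hx
      exact hnew x hxm (Finset.disjoint_left.1 hNB hxN)
  · refine support_stepOfType_subset θ P hT m ?_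
    rw [stepOfType, PMF.mem_support_bind_iff]
    exact ⟨m.arrive T N, (PMF.mem_support_map_iff _ _ _).2 ⟨N, hN, rfl⟩,
      (PMF.mem_support_map_iff _ _ _).2 ⟨M, hM, rfl⟩⟩

theorem Market.mem_hard_arrive {m : Market} {b : ℕ} (h : b ∈ m.hard) (T : AgentType)
    (N : Finset (ℕ × ℕ)) : b ∈ (m.arrive T N).hard := by
  cases T
  · exact Finset.mem_insert_of_mem h
  · exact h

/-- A blocked agent waits at least until a newcomer offers her a compatible item. -/
theorem Blocked.le_stillWaiting (k : ℕ) {m : Market} {b : ℕ} (h : Blocked θ P m b) :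
    ENNReal.ofReal ((1 - (θ.pH : ℝ)) ^ k) ≤ stillWaiting θ P b k m := by
  induction k generalizing m with
  | zero => simp [stillWaiting, h.mem_waiting]
  | succ k ih =>
    rw [stillWaiting, if_pos h.mem_waiting]
    change _ ≤ expect (step θ P m) _
    rw [step, expect_bind, ← expect_const (arrivalType θ) (ENNReal.ofReal _)]
    refine expect_mono fun T hT => ?_
    rw [pow_succ, ENNReal.ofReal_mul (pow_nonneg (sub_nonneg.2 θ.pH.2.2) k)]
    have hne : b ≠ m.fresh := fun hb => m.fresh_notMem_waiting (hb ▸ h.mem_waiting)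
    -- The one new pair pointing to `b` starts at the newcomer. Its probability depends on the
    -- receiver `b` only, so the newcomer's type is irrelevant.
    have key := mul_le_expect_stepOfType (B := {(m.fresh, b)}) hT (Market.mem_hard_arrive h.1 T ∅)
      ?_ ?_ h.2 ?_ (fun m' hm' => ih hm')
    · simpa using key
    · refine Finset.singleton_subset_iff.2 (Finset.mem_union_right _ ?_)
      exact Finset.mem_product.2 ⟨Finset.mem_singleton_self _, h.mem_waiting⟩
    · intro e he
      rw [Finset.mem_singleton.1 he]
    · intro x hx hxB
      rcases Finset.mem_union.1 hx with hx | hx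
      · exact absurd (Finset.mem_singleton.1 (Finset.mem_product.1 hx).2) hne
      · have hxf : x = m.fresh := Finset.mem_singleton.1 (Finset.mem_product.1 hx).1
        exact absurd (Finset.mem_singleton.2 (by rw [hxf])) hxB

open Classical in
/-- A hard-to-match newcomer waits at least until somebody who may leave offers her a compatible
item. -/
theorem le_expect_newcomer_card (hH : AgentType.H ∈ (arrivalType θ).support) (k : ℕ) (m : Market) :
    ENNReal.ofReal ((1 - (θ.pH : ℝ)) ^ k) * ENNReal.ofReal ((1 - (θ.pH : ℝ)) ^
        (m.bridges.card + (m.waiting.filter fun a => waitsForever θ P m a ≠ 1).card)) ≤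
      expect (stepOfType θ P .H m) (stillWaiting θ P m.fresh k) := by
  have hq0 : 0 ≤ 1 - (θ.pH : ℝ) := sub_nonneg.2 θ.pH.2.2
  have hq1 : 1 - (θ.pH : ℝ) ≤ 1 := sub_le_self _ θ.pH.2.1
  set B : Finset (ℕ × ℕ) :=
    (m.nodes.filter fun a => waitsForever θ P m a ≠ 1) ×ˢ {m.fresh} with hBdef
  have hcard : B.card ≤
      m.bridges.card + (m.waiting.filter fun a => waitsForever θ P m a ≠ 1).card := by
    rw [hBdef, Finset.card_product, Finset.card_singleton, mul_one, Market.nodes,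
      Finset.filter_union, add_comm]
    exact (Finset.card_union_le _ _).trans
      (Nat.add_le_add_left (Finset.card_le_card (Finset.filter_subset _ _)) _)
  refine le_trans (mul_le_mul_right (ENNReal.ofReal_le_ofReal
    (pow_le_pow_of_le_one hq0 hq1 hcard)) _) ?_
  refine mul_le_expect_stepOfType (B := B) hH (Finset.mem_insert_self _ _) ?_ ?_ ?_ ?_
    (fun m' hm' => hm'.le_stillWaiting k)
  · exact (Finset.product_subset_product_left (Finset.filter_subset _ _)).trans
      Finset.subset_union_left
  · exact fun e he => Finset.mem_singleton.1 (Finset.mem_product.1 he).2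
  · exact fun x hx => absurd (m.target_mem _ hx) m.fresh_notMem_waiting
  · intro x hx hxB
    rcases Finset.mem_union.1 hx with hx | hx
    · by_contra hu
      exact hxB (Finset.mem_product.2 ⟨Finset.mem_filter.2 ⟨(Finset.mem_product.1 hx).1, hu⟩,
        Finset.mem_singleton_self _⟩)
    · exact absurd (Finset.mem_product.1 hx).2 m.fresh_notMem_waiting

theorem le_expect_newcomer (hH : AgentType.H ∈ (arrivalType θ).support) (k : ℕ) {m : Market}
    (h01 : ∀ a ∈ m.waiting, waitsForever θ P m a = 0 ∨ waitsForever θ P m a = 1) :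
    ENNReal.ofReal ((1 - (θ.pH : ℝ)) ^ k) * (ENNReal.ofReal ((1 - (θ.pH : ℝ)) ^ m.bridges.card) *
        (1 - min 1 (ENNReal.ofReal θ.pH * waitingSum
          (fun m a => isWaiting m a - waitsForever θ P m a) m))) ≤
      expect (stepOfType θ P .H m) (stillWaiting θ P m.fresh k) := by
  classical
  have hq0 : 0 ≤ 1 - (θ.pH : ℝ) := sub_nonneg.2 θ.pH.2.2
  refine le_trans (mul_le_mul_right ?_ _) (le_expect_newcomer_card hH k m)
  set n := (m.waiting.filter fun a => waitsForever θ P m a ≠ 1).card with hn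
  -- The dichotomy `h01` enters here: it turns the sum of the leaving probabilities into the number
  -- of leavers.
  have hsum : waitingSum (fun m a => isWaiting m a - waitsForever θ P m a) m = (n : ℝ≥0∞) := by
    rw [hn, Finset.card_filter, waitingSum]
    push_cast
    refine Finset.sum_congr rfl fun a ha => ?_
    rcases h01 a ha with h | h <;> simp [isWaiting, ha, h]
  rw [pow_add, ENNReal.ofReal_mul (pow_nonneg hq0 _), hsum]
  refine mul_le_mul_right ?_ _
  have hbern : 1 - (θ.pH : ℝ) * n ≤ (1 - (θ.pH : ℝ)) ^ n := by
    have := one_add_mul_le_pow (a := -(θ.pH : ℝ)) (by linarith [θ.pH.2.2]) n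
    rw [← sub_eq_add_neg] at this
    linarith
  have hcast : ENNReal.ofReal θ.pH * (n : ℝ≥0∞) = ENNReal.ofReal (θ.pH * n) := by
    rw [ENNReal.ofReal_mul θ.pH.2.1, ENNReal.ofReal_natCast]
  rw [hcast]
  rcases le_total 1 (ENNReal.ofReal (θ.pH * n)) with h | h
  · rw [min_eq_left h, tsub_self]
    exact zero_le
  · rw [min_eq_right h, ← ENNReal.ofReal_one,
      ← ENNReal.ofReal_sub _ (mul_nonneg θ.pH.2.1 (Nat.cast_nonneg n))]
    exact ENNReal.ofReal_le_ofReal hbern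

/-! ### Waiting times -/

theorem expect_arrivalType (θ : Params) (f : AgentType → ℝ≥0∞) :
    expect (arrivalType θ) f = ((θ.lamH / θ.totalRate : ℝ≥0) : ℝ≥0∞) * f .H +
      ((1 - θ.lamH / θ.totalRate : ℝ≥0) : ℝ≥0∞) * f .E := by
  rw [arrivalType, expect_map, expect, tsum_fintype, Fintype.sum_bool]
  rfl

theorem mem_support_arrivalType (hH : 0 < θ.lamH) : AgentType.H ∈ (arrivalType θ).support := by
  refine (PMF.mem_support_map_iff _ _ _).2 ⟨true, ?_, rfl⟩
  rw [PMF.mem_support_ofFintype_iff]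
  have : 0 < θ.lamH / θ.totalRate := div_pos hH (lt_of_lt_of_le hH le_self_add)
  exact ENNReal.coe_ne_zero.2 this.ne'

theorem tsum_newcomerStillWaiting (hH : 0 < θ.lamH) (ρ : PMF Market) {T : AgentType}
    (hT : θ.rate T ≠ 0) :
    ∑' k, newcomerStillWaiting θ P ρ T k = θ.totalRate * waitingTime θ P ρ T := by
  have h0 : (θ.totalRate : ℝ≥0∞) ≠ 0 :=
    ENNReal.coe_ne_zero.2 (lt_of_lt_of_le hH le_self_add).ne'
  rw [waitingTime_eq θ P ρ T hT, ← mul_assoc, ENNReal.mul_inv_cancel h0 ENNReal.coe_ne_top, one_mul]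

theorem newcomerMean_stillWaiting (ρ : PMF Market) (k : ℕ) :
    newcomerMean θ P ρ (fun m a => stillWaiting θ P a k m) =
      ((θ.lamH / θ.totalRate : ℝ≥0) : ℝ≥0∞) * newcomerStillWaiting θ P ρ .H k +
        ((1 - θ.lamH / θ.totalRate : ℝ≥0) : ℝ≥0∞) * newcomerStillWaiting θ P ρ .E k := by
  simp only [newcomerMean, step, expect_bind, expect_arrivalType, expect_add, expect_mul_left]
  rfl

/-- The expected number of arrivals that a newcomer sees while waiting. -/
theorem tsum_newcomerMean_le (hH : 0 < θ.lamH) (ρ : PMF Market) :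
    ∑' k, newcomerMean θ P ρ (fun m a => stillWaiting θ P a k m) ≤
      θ.totalRate * (waitingTime θ P ρ .H + waitingTime θ P ρ .E) := by
  simp only [newcomerMean_stillWaiting, ENNReal.tsum_add, ENNReal.tsum_mul_left, mul_add]
  have htot : θ.totalRate ≠ 0 := (lt_of_lt_of_le hH le_self_add).ne'
  refine add_le_add ?_ ?_
  · rw [tsum_newcomerStillWaiting hH ρ (T := .H) hH.ne']
    refine mul_le_of_le_one_left zero_le (ENNReal.coe_le_one_iff.2 ?_)
    exact div_le_one_of_le₀ le_self_add zero_le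
  -- If no easy agents arrive, their waiting time is `0` by convention and bounds nothing; the
  -- mixture weight vanishes instead.
  · by_cases hE : θ.lamE = 0
    · have h1 : θ.lamH / θ.totalRate = 1 := by
        have : θ.totalRate = θ.lamH := by rw [Params.totalRate, hE, add_zero]
        rw [this, div_self hH.ne']
      rw [h1, tsub_self, ENNReal.coe_zero, zero_mul]
      exact zero_le
    · rw [tsum_newcomerStillWaiting hH ρ (T := .E) hE]
      exact mul_le_of_le_one_left zero_le (ENNReal.coe_le_one_iff.2 tsub_le_self)

/-- The waiting time of hard-to-match agents is at least the time until the first usable edge. -/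
theorem IsSteadyState.le_waitingTime {d : ℕ} {ρ : PMF Market} (h : IsSteadyState θ d P ρ)
    (hH : 0 < θ.lamH) (hfin : waitingTime θ P ρ .H + waitingTime θ P ρ .E ≠ ∞) :
    (θ.totalRate : ℝ≥0∞)⁻¹ * ((ENNReal.ofReal θ.pH)⁻¹ *
        (ENNReal.ofReal ((1 - (θ.pH : ℝ)) ^ d) * (1 - ENNReal.ofReal θ.pH *
          (θ.totalRate * (waitingTime θ P ρ .H + waitingTime θ P ρ .E))))) ≤
      waitingTime θ P ρ .H := by
  have hsupp := mem_support_arrivalType hH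
  set S := waitingTime θ P ρ .H + waitingTime θ P ρ .E with hS
  have hn := tsum_newcomerMean_le (P := P) hH ρ
  rw [← hS] at hn
  have hnfin := ne_top_of_le_ne_top (ENNReal.mul_ne_top ENNReal.coe_ne_top hfin) hn
  have hX : expect ρ (fun m => min 1 (ENNReal.ofReal θ.pH * waitingSum
      (fun m a => isWaiting m a - waitsForever θ P m a) m)) ≤
      ENNReal.ofReal θ.pH * (θ.totalRate * S) :=
    (expect_min_leavers_le h.stationary ENNReal.ofReal_ne_top).trans (mul_le_mul_right hn _)
  have hk : ∀ k, ENNReal.ofReal (1 - (θ.pH : ℝ)) ^ k *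
      (ENNReal.ofReal ((1 - (θ.pH : ℝ)) ^ d) * (1 - ENNReal.ofReal θ.pH * (θ.totalRate * S))) ≤
      newcomerStillWaiting θ P ρ .H k := by
    intro k
    refine le_trans ?_ (expect_mono (μ := ρ) fun m hm =>
      le_expect_newcomer hsupp k fun a ha => waitsForever_eq_zero_or_one h.stationary hnfin hm ha)
    rw [ENNReal.ofReal_pow (sub_nonneg.2 θ.pH.2.2) k, expect_mul_left]
    refine mul_le_mul_right ?_ _
    rw [expect_congr (μ := ρ) fun m hm => by rw [h.card_bridges hm], expect_mul_left]
    -- Subtraction in `ℝ≥0∞` is truncated, so one minus the mean of the truncated count is compared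
    -- with the mean of its complement by adding the two.
    refine mul_le_mul_right ((tsub_le_tsub_left hX 1).trans (tsub_le_iff_right.2 ?_)) _
    rw [← expect_add]
    simp only [tsub_add_cancel_of_le (min_le_left _ _), expect_const, le_refl]
  have hgeo : ∑' k : ℕ, ENNReal.ofReal (1 - (θ.pH : ℝ)) ^ k = (ENNReal.ofReal θ.pH)⁻¹ := by
    rw [ENNReal.tsum_geometric, ← ENNReal.ofReal_one,
      ← ENNReal.ofReal_sub _ (sub_nonneg.2 θ.pH.2.2), sub_sub_cancel]
  rw [waitingTime_eq θ P ρ .H hH.ne', ← hgeo, ← ENNReal.tsum_mul_right]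
  exact mul_le_mul_right (ENNReal.tsum_le_tsum hk) _

end DynamicMatching

/-! ### Solving the inequality for the total waiting time -/

theorem mainTheorem11 (d : ℕ) (pE : I) (lamH lamE : ℝ≥0) (hlamH : 0 < lamH)
    (pmax : ℝ) (hpmax : d = 0 ∨ pmax < 1) :
    ∃ c : ℝ, 0 < c ∧ ∀ pH : I, 0 < (pH : ℝ) → (pH : ℝ) ≤ pmax →
      ∀ (P : DynamicMatching.Policy) (ρ : PMF DynamicMatching.Market),
        DynamicMatching.IsSteadyState ⟨lamH, lamE, pH, pE⟩ d P ρ →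
          ENNReal.ofReal (c / pH) ≤
            DynamicMatching.waitingTime ⟨lamH, lamE, pH, pE⟩ P ρ .H +
              DynamicMatching.waitingTime ⟨lamH, lamE, pH, pE⟩ P ρ .E := by
  -- `δ` bounds from below the chance that none of the `d` bridge agents is compatible. Without
  -- chains it is `1` even at `pH = 1`; otherwise `pmax < 1` keeps it positive.
  obtain ⟨δ, hδ, hδle⟩ : ∃ δ : ℝ, 0 < δ ∧
      ∀ pH : I, (pH : ℝ) ≤ pmax → δ ≤ (1 - (pH : ℝ)) ^ d := by
    rcases hpmax with rfl | h
    · exact ⟨1, one_pos, fun _ _ => by simp⟩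
    · exact ⟨(1 - pmax) ^ d, pow_pos (sub_pos.2 h) d, fun pH hp =>
        pow_le_pow_left₀ (sub_pos.2 h).le (by linarith) d⟩
  set l : ℝ := ((lamH + lamE : ℝ≥0) : ℝ) with hl
  have hl0 : 0 < l := NNReal.coe_pos.2 (lt_of_lt_of_le hlamH le_self_add)
  -- The solution of `δ * (1 - p*l*s) = l*p*s` is `s = δ / ((1 + δ) * l * p)`.
  refine ⟨δ / ((1 + δ) * l), by positivity, fun pH hp0 hple P ρ hρ => ?_⟩
  by_cases hfin : DynamicMatching.waitingTime ⟨lamH, lamE, pH, pE⟩ P ρ .H +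
      DynamicMatching.waitingTime ⟨lamH, lamE, pH, pE⟩ P ρ .E = ∞
  · rw [hfin]
    exact le_top
  have key := (hρ.le_waitingTime hlamH hfin).trans
    (le_self_add (b := DynamicMatching.waitingTime ⟨lamH, lamE, pH, pE⟩ P ρ .E))
  obtain ⟨s, hs0, hs⟩ : ∃ s : ℝ, 0 ≤ s ∧
      DynamicMatching.waitingTime ⟨lamH, lamE, pH, pE⟩ P ρ .H +
        DynamicMatching.waitingTime ⟨lamH, lamE, pH, pE⟩ P ρ .E = ENNReal.ofReal s :=
    ⟨_, ENNReal.toReal_nonneg, (ENNReal.ofReal_toReal hfin).symm⟩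
  have hrate : ((DynamicMatching.Params.totalRate ⟨lamH, lamE, pH, pE⟩ : ℝ≥0) : ℝ≥0∞) =
      ENNReal.ofReal l := (ENNReal.ofReal_coe_nnreal).symm
  have hq : (0 : ℝ) ≤ (1 - (pH : ℝ)) ^ d := pow_nonneg (sub_nonneg.2 pH.2.2) d
  rw [hs, hrate, ← ENNReal.ofReal_inv_of_pos hl0, ← ENNReal.ofReal_inv_of_pos hp0,
    ← ENNReal.ofReal_mul hl0.le, ← ENNReal.ofReal_mul hp0.le, ← ENNReal.ofReal_one,
    ← ENNReal.ofReal_sub _ (by positivity), ← ENNReal.ofReal_mul hq,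
    ← ENNReal.ofReal_mul (by positivity), ← ENNReal.ofReal_mul (by positivity),
    ENNReal.ofReal_le_ofReal_iff hs0] at key
  rw [hs]
  refine ENNReal.ofReal_le_ofReal ?_
  -- Replacing `(1 - pH)^d` by `δ` in `key` needs a nonnegative factor. If the factor is
  -- nonpositive, `s` is already at least `1 / (pH * l)`.
  rcases le_total (1 - (pH : ℝ) * (l * s)) 0 with h | h
  · have h1 : 1 / ((pH : ℝ) * l) ≤ s := by
      rw [div_le_iff₀ (by positivity)]
      linarith
    refine le_trans ?_ h1
    rw [div_div, div_le_div_iff₀ (by positivity) (by positivity)]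
    have : (0 : ℝ) < (pH : ℝ) * l := by positivity
    nlinarith
  · have h1 : l⁻¹ * ((pH : ℝ)⁻¹ * (δ * (1 - (pH : ℝ) * (l * s)))) ≤ s := by
      refine le_trans ?_ key
      gcongr
      exact hδle pH hple
    have h2 : δ * (1 - (pH : ℝ) * (l * s)) ≤ s * (l * pH) := by
      have := mul_le_mul_of_nonneg_right h1 (show 0 ≤ l * (pH : ℝ) by positivity)
      refine le_of_eq_of_le ?_ this
      field_simp
    rw [div_div, div_le_iff₀ (by positivity)]
    linarith
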